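/- Let $k \ge 2$ be an integer and let $\Omega(k)$ denote the number of prime factors of $k$, counted with multiplicity. Let $G$ be a complete undirected simple graph of order $k + 1 + 2\Omega(k)$, and suppose that every vertex and every edge of $G$ is assigned a weight in $\mathbb{Z}_k$, the group of integers modulo $k$. Then $G$ contains a cycle of weight $0$, that is, a cycle (of length at least $3$) for which the sum in $\mathbb{Z}_k$ of the weights of all its vertices and all its edges is $0$. -/

import Mathlib

/-- The weight of a subgraph `H` of a graph on the vertex set `V` with vertex weights `wV` and
edge weights `wE`: the sum of the weights of the vertices and of the edges of `H`. Only the values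
of `wE` at edges of `H` matter. -/
noncomputable def SimpleGraph.Subgraph.weight {V : Type*} {G : SimpleGraph V} {A : Type*}
    [AddCommMonoid A] (wV : V → A) (wE : Sym2 V → A) (H : G.Subgraph) : A :=
  (∑ᶠ v ∈ H.verts, wV v) + ∑ᶠ e ∈ H.edgeSet, wE e

/-!
Counting every vertex together with the arc that enters it turns the weights into arc weights `w`
with values in a finite abelian group, whose two orientations differ by a potential (`Reversible`).
Suppose that no cycle with at least three vertices has weight zero. For a nontrivial subgroup `K`
that contains all the weights, `manyPathWeights` says that the paths from `a` to `b` through a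
nonempty set `S` of further vertices have at least `min (|K| - 1) (|S| + 1 - 2 Ω(|K|))` different
weights. Once there are `|K| + 1 + 2 Ω(|K|)` vertices, the path weights from `a` to `b` are
therefore all elements of `K` other than `-w b a`, and this is still true after a vertex has been
removed. Comparing the two statements gives `w b x = w b a + w a x`, so triangles that avoid `b` have
weight zero (`ManyPathWeights.card_le`).

The number of path weights is bounded by induction on `K` and on `S`. If the set `R` of path weights
is too small, consider the defects `δ x y = w a y - w a x - w x y` of the arcs in `S`. Paths that
start with `a → y` can be rerouted through `a → x → y`, and the induction hypothesis shows that
translation by `-δ x y` moves at most one element out of `R`. Cycles have opposite weights for `δ` and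
`w`. If the defects generate a proper subgroup `K'`, then the induction hypothesis for `K'` applies
to `δ`, and the two units that `2 Ω` loses when passing to `K'` give a contradiction. If they
generate `K`, then `R` is an arithmetic progression whose difference `d` generates `K`, and all
defects are `0`, `d` or `-d` (`exists_arithmetic_progression`).

In the latter case the defects lift to integers in `{-1, 0, 1}`. The integral sums along the paths
that end at a vertex `z` change by at most one when a path is lengthened at its far end, and they
stay in the residues prescribed by `R`; as `R` misses at least two residues, they remain in a window
of `|R|` integers (`ncard_backSums_le`). On the other hand the sets of integral path sums grow with
the number of available vertices (`exists_backSums_growth`): if adding no single vertex makes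
the sets of all others grow, then comparing maxima produces a cycle of sum zero or two opposite arcs
that cancel. Vertices joined by cancelling arcs are kept apart by a colouring, and every colour
beyond the first costs one (`exists_card_le_backSums`). Cycles of cancelling arcs have order two by
reversibility, so in a cyclic group they are scarce: two colours suffice if `|K|` is an odd prime and
three in general (`exists_two_colouring`, `exists_three_colouring`). Either number of colours is at
most `2 Ω(|K|)`, and `S` has at least `|R| + 2 Ω(|K|)` vertices, so some set of integral path sums has
more than `|R|` elements and does not fit into the window.
-/

/-! ### Weights of paths and cycles -/

section PathWeight

variable {V A : Type*} [AddCommGroup A]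

/-- The weight of the directed path that starts at `a`, runs through the vertices of the list `l`
in order and ends at `b`, where `w x y` is the weight of the arc from `x` to `y`. For `b = a` this
is the weight of a closed walk. -/
def pathWeight (w : V → V → A) : V → List V → V → A
  | a, [], b => w a b
  | a, x :: l, b => w a x + pathWeight w x l b

@[simp] lemma pathWeight_nil (w : V → V → A) (a b : V) : pathWeight w a [] b = w a b := rfl

@[simp] lemma pathWeight_cons (w : V → V → A) (a x : V) (l : List V) (b : V) :
    pathWeight w a (x :: l) b = w a x + pathWeight w x l b := rfl

lemma pathWeight_append (w : V → V → A) (a : V) (l : List V) (x : V) (l' : List V) (b : V) :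
    pathWeight w a (l ++ x :: l') b = pathWeight w a l x + pathWeight w x l' b := by
  induction l generalizing a with
  | nil => simp
  | cons y l ih => simp [ih, add_assoc]

/-- No directed cycle with at least three vertices, all of them in `T`, has weight zero. -/
def ZeroCycleFree (w : V → V → A) (T : Finset V) : Prop :=
  ∀ a ∈ T, ∀ l : List V, l.Nodup → a ∉ l → (∀ x ∈ l, x ∈ T) → 2 ≤ l.length →
    pathWeight w a l a ≠ 0

lemma ZeroCycleFree.mono {w : V → V → A} {T T' : Finset V} (h : ZeroCycleFree w T)
    (hT : T' ⊆ T) : ZeroCycleFree w T' :=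
  fun a ha l hl hal hlT h2 => h a (hT ha) l hl hal (fun x hx => hT (hlT x hx)) h2

lemma ZeroCycleFree.triangle {w : V → V → A} {T : Finset V} (h : ZeroCycleFree w T) {x y z : V}
    (hx : x ∈ T) (hy : y ∈ T) (hz : z ∈ T) (hxy : x ≠ y) (hyz : y ≠ z) (hxz : x ≠ z) :
    w x y + w y z + w z x ≠ 0 := by
  have := h x hx [y, z] (by simp [hyz]) (by simp [hxy, hxz]) (by simp [hy, hz]) (by simp)
  simpa [add_assoc] using this

/-- Arc weights that differ from a symmetric weighting by a potential: the two orientations of any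
cycle have the same weight. -/
def Reversible (w : V → V → A) : Prop :=
  ∃ β : V → A, ∀ x y, w x y - w y x = β y - β x

/-- The set of weights of the paths from `a` to `b` with at least one interior vertex, all
interior vertices being in `S`. -/
def pathWeights (w : V → V → A) (S : Finset V) (a b : V) : Set A :=
  {g | ∃ l : List V, l ≠ [] ∧ l.Nodup ∧ (∀ x ∈ l, x ∈ S) ∧ pathWeight w a l b = g}

lemma pathWeights_nonempty (w : V → V → A) {S : Finset V} (h : S.Nonempty) (a b : V) :
    (pathWeights w S a b).Nonempty := by
  obtain ⟨x, hx⟩ := h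
  exact ⟨_, [x], by simp, by simp, by simpa using hx, rfl⟩

lemma add_mem_pathWeights [DecidableEq V] (w : V → V → A) {S S' : Finset V} {a b x : V}
    (hx : x ∈ S) (hS' : S' ⊆ S.erase x) {g : A} (hg : g ∈ pathWeights w S' x b) :
    w a x + g ∈ pathWeights w S a b := by
  obtain ⟨l, h0, hl, hlS, rfl⟩ := hg
  refine ⟨x :: l, by simp, ?_, ?_, rfl⟩
  · refine List.nodup_cons.2 ⟨fun h => ?_, hl⟩
    exact (Finset.mem_erase.1 (hS' (hlS x h))).1 rfl
  · intro y hy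
    rcases List.mem_cons.1 hy with rfl | hy
    · exact hx
    · exact Finset.mem_of_mem_erase (hS' (hlS y hy))

/-- A relation between two groups that is compatible with addition passes from the arcs between
distinct vertices of `T` to paths and cycles in `T`. -/
lemma pathWeight_rel {A' : Type*} [AddCommGroup A'] {P : A → A' → Prop}
    (hP : ∀ g g' h h', P g g' → P h h' → P (g + h) (g' + h')) {w : V → V → A} {w' : V → V → A'}
    {T : Finset V} (hT : ∀ x ∈ T, ∀ y ∈ T, x ≠ y → P (w x y) (w' x y)) {a : V} {l : List V} {b : V}
    (ha : a ∈ T) (hb : b ∈ T) (hlT : ∀ x ∈ l, x ∈ T) (hl : l.Nodup) (hal : a ∉ l) (hbl : b ∉ l)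
    (hab : a = b → l ≠ []) : P (pathWeight w a l b) (pathWeight w' a l b) := by
  induction l generalizing a with
  | nil => exact hT a ha b hb (fun h => hab h rfl)
  | cons x l ih =>
    simp only [List.mem_cons, not_or, List.nodup_cons, forall_eq_or_imp] at *
    exact hP _ _ _ _ (hT a ha x hlT.1 hal.1)
      (ih hlT.1 hlT.2 hl.2 hl.1 hbl.2 (fun h => absurd h.symm hbl.1))

lemma pathWeight_mem {w : V → V → A} {K : AddSubgroup A} {T : Finset V}
    (hK : ∀ x ∈ T, ∀ y ∈ T, x ≠ y → w x y ∈ K) {a : V} {l : List V} {b : V}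
    (ha : a ∈ T) (hb : b ∈ T) (hlT : ∀ x ∈ l, x ∈ T) (hl : l.Nodup) (hal : a ∉ l) (hbl : b ∉ l)
    (hab : a = b → l ≠ []) : pathWeight w a l b ∈ K :=
  pathWeight_rel (P := fun g _ => g ∈ K) (fun _ _ _ _ h h' => K.add_mem h h') (w' := w) hK
    ha hb hlT hl hal hbl hab

lemma pathWeights_subset {w : V → V → A} {K : AddSubgroup A} {T : Finset V}
    (hK : ∀ x ∈ T, ∀ y ∈ T, x ≠ y → w x y ∈ K) {S : Finset V} (hS : S ⊆ T) {a b : V}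
    (ha : a ∈ T) (hb : b ∈ T) (haS : a ∉ S) (hbS : b ∉ S) (hab : a ≠ b) :
    pathWeights w S a b ⊆ K := by
  rintro g ⟨l, h0, hl, hlS, rfl⟩
  exact pathWeight_mem hK ha hb (fun x hx => hS (hlS x hx)) hl (fun h => haS (hlS a h))
    (fun h => hbS (hlS b h)) (fun h => absurd h hab)

/-! ### The defect of an arc -/

/-- The defect of the arc `x → y` with respect to a potential `α`: how much larger than the weight
of the arc the difference of the potential is. -/
def defect (α : V → A) (w : V → V → A) (x y : V) : A := α y - α x - w x y

lemma pathWeight_defect (α : V → A) (w : V → V → A) (a : V) (l : List V) (b : V) :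
    pathWeight (defect α w) a l b = α b - α a - pathWeight w a l b := by
  induction l generalizing a with
  | nil => rfl
  | cons x l ih => simp only [pathWeight_cons, ih, defect]; abel

lemma zeroCycleFree_defect {w : V → V → A} {T : Finset V} (h : ZeroCycleFree w T) (α : V → A) :
    ZeroCycleFree (defect α w) T := by
  intro a ha l hl hal hlT h2 h0
  rw [pathWeight_defect] at h0
  exact h a ha l hl hal hlT h2 (by simpa using h0)

lemma reversible_defect {w : V → V → A} (h : Reversible w) (α : V → A) :
    Reversible (defect α w) := by
  obtain ⟨β, hβ⟩ := h
  refine ⟨fun x => α x + α x - β x, fun x y => ?_⟩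
  have h1 : defect α w x y - defect α w y x = α y + α y - (α x + α x) - (w x y - w y x) := by
    unfold defect; abel
  rw [h1, hβ]
  beta_reduce
  abel

end PathWeight

/-! ### Integer weights: growth of the set of path sums -/

section BackSum

variable {V A : Type*} [AddCommGroup A]

/-- The weight of the path that ends at `b` and whose earlier vertices, read backwards from `b`,
are the members of the list. -/
def backSum (w : V → V → A) : V → List V → A
  | _, [] => 0
  | b, x :: l => backSum w x l + w x b

@[simp] lemma backSum_nil (w : V → V → A) (b : V) : backSum w b [] = 0 := rfl

@[simp] lemma backSum_cons (w : V → V → A) (b x : V) (l : List V) :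
    backSum w b (x :: l) = backSum w x l + w x b := rfl

/-- Lengthening a path at its beginning adds the weight of a single arc. -/
lemma exists_backSum_append_singleton (w : V → V → A) (b : V) (l : List V) (x : V) :
    ∃ y, backSum w b (l ++ [x]) = backSum w b l + w x y := by
  induction l generalizing b with
  | nil => exact ⟨b, by simp⟩
  | cons z l ih =>
    obtain ⟨y, hy⟩ := ih z
    refine ⟨y, ?_⟩
    simp only [List.cons_append, backSum_cons, hy]
    abel

/-- The set of all weights of paths that end at `b` and whose earlier vertices lie in `U`; the path
that consists of `b` alone is included. -/
def backSums (w : V → V → A) (U : Finset V) (b : V) : Set A :=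
  {g | ∃ l : List V, l.Nodup ∧ (∀ x ∈ l, x ∈ U) ∧ backSum w b l = g}

lemma backSums_mono (w : V → V → A) {U U' : Finset V} (h : U ⊆ U') (b : V) :
    backSums w U b ⊆ backSums w U' b := by
  rintro g ⟨l, hl, hU, rfl⟩
  exact ⟨l, hl, fun x hx => h (hU x hx), rfl⟩

lemma zero_mem_backSums (w : V → V → A) (U : Finset V) (b : V) : 0 ∈ backSums w U b :=
  ⟨[], by simp, by simp, rfl⟩

lemma backSums_finite [Finite V] (w : V → V → A) (U : Finset V) (b : V) :
    (backSums w U b).Finite := by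
  classical
  have := Fintype.ofFinite V
  refine (Set.finite_range (fun l : {l : List V // l.Nodup} => backSum w b l)).subset ?_
  rintro g ⟨l, hl, -, rfl⟩
  exact ⟨⟨l, hl⟩, rfl⟩

lemma image_backSums_subset [DecidableEq V] (w : V → V → A) {U : Finset V} {b : V} (hb : b ∉ U)
    (c : V) : (fun g => g + w b c) '' backSums w U b ⊆ backSums w (insert b U) c := by
  rintro _ ⟨_, ⟨l, hl, hU, rfl⟩, rfl⟩
  refine ⟨b :: l, List.nodup_cons.2 ⟨fun h => hb (hU b h), hl⟩, ?_, rfl⟩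
  intro x hx
  rcases List.mem_cons.1 hx with rfl | hx
  · exact Finset.mem_insert_self _ _
  · exact Finset.mem_insert_of_mem (hU x hx)

lemma pathWeight_iterate (w : V → V → A) (f : V → V) (M : V → A) {C : Set V}
    (hC : ∀ x ∈ C, f x ∈ C ∧ M (f x) = M x + w x (f x)) (n : ℕ) {x : V} (hx : x ∈ C) :
    pathWeight w x (List.iterate f (f x) n) (f^[n + 1] x) = M (f^[n + 1] x) - M x := by
  induction n generalizing x with
  | zero => simp [(hC x hx).2]
  | succ n ih =>
    have h := ih (hC x hx).1
    rw [Function.iterate_succ_apply, List.iterate, pathWeight_cons, h, (hC x hx).2]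
    abel

/-- If the weights of the arcs `x → f x` are the differences of a function `M`, where `f` has no
fixed points on the finite set `C`, then iterating `f` closes up to a cycle of weight zero. It has
at least three vertices as soon as no two opposite arcs cancel. -/
lemma not_exists_self_map {w : V → V → A} {C : Finset V} (hw : ZeroCycleFree w C)
    (hnull : ∀ x ∈ C, ∀ y ∈ C, x ≠ y → w x y + w y x ≠ 0) (hne : C.Nonempty) (f : V → V) (M : V → A)
    (hf : ∀ x ∈ C, f x ∈ C) (hfx : ∀ x ∈ C, f x ≠ x) (hM : ∀ x ∈ C, M (f x) = M x + w x (f x)) :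
    False := by
  obtain ⟨x₀, hx₀⟩ := hne
  have hit : ∀ n, ∀ x ∈ C, f^[n] x ∈ C := by
    intro n
    induction n with
    | zero => intro x hx; exact hx
    | succ n ih => intro x hx; exact ih _ (hf x hx)
  obtain ⟨x, hx, hper⟩ : ∃ x ∈ C, x ∈ Function.periodicPts f := by
    obtain ⟨i, -, j, -, hij, h⟩ := Set.infinite_univ.exists_ne_map_eq_of_mapsTo
      (f := fun n : ℕ => f^[n] x₀) (t := (C : Set V)) (fun n _ => hit n x₀ hx₀) C.finite_toSet
    wlog hlt : i < j generalizing i j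
    · exact this j i hij.symm h.symm (by omega)
    refine ⟨f^[i] x₀, hit i x₀ hx₀, Function.mk_mem_periodicPts (n := j - i) (by omega) ?_⟩
    change f^[j - i] (f^[i] x₀) = f^[i] x₀
    rw [← Function.iterate_add_apply, Nat.sub_add_cancel hlt.le]
    exact h.symm
  have hp := Function.minimalPeriod_pos_of_mem_periodicPts hper
  have hinj := Function.iterate_injOn_Iio_minimalPeriod (f := f) (x := x)
  have hend : f^[Function.minimalPeriod f x] x = x := Function.iterate_minimalPeriod
  set p := Function.minimalPeriod f x
  have hp1 : p ≠ 1 := by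
    intro h
    rw [h] at hend
    exact hfx x hx hend
  have hp2 : p ≠ 2 := by
    intro h
    rw [h] at hend
    change f (f x) = x at hend
    have h1 := hM x hx
    have h2 := hM _ (hf x hx)
    rw [hend, h1] at h2
    refine hnull x hx (f x) (hf x hx) (hfx x hx).symm ?_
    have h3 : M x + (w x (f x) + w (f x) x) = M x + 0 := by
      rw [add_zero, ← add_assoc]; exact h2.symm
    exact add_left_cancel h3
  have hlist : ∀ y, y ∈ List.iterate f (f x) (p - 1) → ∃ i, 0 < i ∧ i < p ∧ f^[i] x = y := by
    intro y hy
    obtain ⟨i, hi, rfl⟩ := List.mem_iterate.1 hy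
    exact ⟨i + 1, by omega, by omega, rfl⟩
  refine hw x hx (List.iterate f (f x) (p - 1)) ?_ ?_ ?_ ?_ ?_
  · rw [List.nodup_iff_injective_getElem]
    intro i j h
    simp only [List.getElem_iterate, ← Function.iterate_succ_apply] at h
    have hi := i.2
    have hj := j.2
    simp only [List.length_iterate] at hi hj
    have := hinj (Set.mem_Iio.2 (by omega)) (Set.mem_Iio.2 (by omega)) h
    exact Fin.ext (by omega)
  · intro h
    obtain ⟨i, hi0, hip, hi⟩ := hlist x h
    have := hinj (Set.mem_Iio.2 hip) (Set.mem_Iio.2 hp) (x₂ := 0) hi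
    omega
  · intro y hy
    obtain ⟨i, -, -, rfl⟩ := hlist y hy
    exact hit i x hx
  · rw [List.length_iterate]; omega
  · have h := pathWeight_iterate w f M (C := (C : Set V)) (fun y hy => ⟨hf y hy, hM y hy⟩) (p - 1) hx
    rw [Nat.sub_add_cancel hp, hend] at h
    rw [h, sub_self]

end BackSum

section Growth

variable {V : Type*} [Finite V] [DecidableEq V]

/-- A set `C` of vertices in which no two opposite arcs cancel can be added to `U` one vertex after
another, so that each vertex but the last enlarges the set of path sums. -/
lemma exists_backSums_growth {e : V → V → ℤ} (C : Finset V) :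
    ∀ (U : Finset V) (t : ℕ), Disjoint U C → C.Nonempty → ZeroCycleFree e C →
      (∀ x ∈ C, ∀ y ∈ C, x ≠ y → e x y + e y x ≠ 0) →
      (∀ z ∈ C, t ≤ (backSums e U z).ncard) →
      ∃ z ∈ C, t + C.card ≤ (backSums e ((U ∪ C).erase z) z).ncard + 1 := by
  induction C using Finset.strongInduction with
  | H C ih =>
  intro U t hUC hne hz hnull ht
  have hnU : ∀ x ∈ C, x ∉ U := fun x hx hU => Finset.disjoint_left.1 hUC hU hx
  by_cases hgrow : ∃ x ∈ C, ∀ z ∈ C, z ≠ x → t + 1 ≤ (backSums e (insert x U) z).ncard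
  · obtain ⟨x, hx, hgrow⟩ := hgrow
    by_cases hC : (C.erase x).Nonempty
    · obtain ⟨z, hzC, hzt⟩ := ih (C.erase x) (Finset.erase_ssubset hx) (insert x U) (t + 1)
        (by
          rw [Finset.disjoint_insert_left]
          exact ⟨Finset.notMem_erase x C, hUC.mono_right (Finset.erase_subset _ _)⟩)
        hC (hz.mono (Finset.erase_subset _ _))
        (fun a ha b hb => hnull a (Finset.mem_of_mem_erase ha) b (Finset.mem_of_mem_erase hb))
        (fun a ha => hgrow a (Finset.mem_of_mem_erase ha) (Finset.ne_of_mem_erase ha))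
      refine ⟨z, Finset.mem_of_mem_erase hzC, ?_⟩
      have hU : insert x U ∪ C.erase x = U ∪ C := by
        ext y
        simp only [Finset.mem_union, Finset.mem_insert, Finset.mem_erase]
        by_cases hy : y = x
        · subst hy; simp [hx]
        · simp [hy]
      rw [hU, Finset.card_erase_of_mem hx] at hzt
      have := Finset.card_pos.2 hne
      omega
    · have hCx : C = {x} := by
        rw [Finset.not_nonempty_iff_eq_empty, Finset.erase_eq_empty_iff] at hC
        rcases hC with h | h
        · exact absurd h hne.ne_empty
        · exact h
      refine ⟨x, hx, ?_⟩
      have hsub : U ⊆ (U ∪ C).erase x := fun y hy =>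
        Finset.mem_erase.2 ⟨fun h => hnU x hx (h ▸ hy), Finset.mem_union_left _ hy⟩
      have h1 := ht x hx
      have h2 := Set.ncard_le_ncard (backSums_mono e hsub x) (backSums_finite e _ x)
      have h3 : C.card = 1 := by rw [hCx]; rfl
      omega
  · exfalso
    push Not at hgrow
    have hgreat : ∀ x, ∃ M, IsGreatest (backSums e U x) M := fun x => by
      obtain ⟨M, hM, hle⟩ := Set.exists_max_image _ id (backSums_finite e U x)
        ⟨0, zero_mem_backSums e U x⟩
      exact ⟨M, hM, fun y hy => hle y hy⟩
    choose M hM using hgreat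
    choose! f hfC hfx hft using hgrow
    refine not_exists_self_map hz hnull hne f M hfC hfx fun x hx => ?_
    -- Both sets of path sums have at least `t` elements and lie in a set with at most `t` elements.
    have hfin := backSums_finite e (insert x U) (f x)
    have hinj : Function.Injective (fun g : ℤ => g + e x (f x)) := add_left_injective _
    have h1 := Set.eq_of_subset_of_ncard_le (image_backSums_subset e (hnU x hx) (f x))
      (by
        rw [Set.ncard_image_of_injective _ hinj]
        have h1 := hft x hx
        have h2 := ht x hx
        omega) hfin
    have h2 := Set.eq_of_subset_of_ncard_le
      (backSums_mono e (Finset.subset_insert x U) (f x))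
      (by
        have h1 := hft x hx
        have h2 := ht _ (hfC x hx)
        omega) hfin
    refine IsGreatest.unique (hM (f x)) ?_
    rw [h2, ← h1]
    refine ⟨⟨_, (hM x).1, rfl⟩, ?_⟩
    rintro _ ⟨g, hg, rfl⟩
    exact add_le_add_left ((hM x).2 hg) _

/-- The path sums grow with the number of vertices, up to a loss of one for every colour class
beyond the first in a colouring of the pairs of cancelling opposite arcs. -/
lemma exists_card_le_backSums {e : V → V → ℤ} (c : V → ℕ) (m : ℕ) :
    ∀ X : Finset V, X.Nonempty → ZeroCycleFree e X → (∀ x ∈ X, c x < m) →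
      (∀ x ∈ X, ∀ y ∈ X, x ≠ y → e x y + e y x = 0 → c x ≠ c y) →
      ∃ z ∈ X, X.card + 1 ≤ (backSums e (X.erase z) z).ncard + m := by
  induction m with
  | zero =>
    rintro X ⟨x, hx⟩ - hc
    exact absurd (hc x hx) (Nat.not_lt_zero _)
  | succ m ih =>
    intro X hX hz hc hnull
    obtain ⟨C, hC⟩ : ∃ C, C = X.filter (fun x => c x = m) := ⟨_, rfl⟩
    obtain ⟨Y, hY⟩ : ∃ Y, Y = X.filter (fun x => ¬ c x = m) := ⟨_, rfl⟩
    have hYX : Y ⊆ X := hY ▸ Finset.filter_subset _ _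
    have hCX : C ⊆ X := hC ▸ Finset.filter_subset _ _
    have hcup : Y ∪ C = X := by
      rw [hY, hC, Finset.union_comm]; exact Finset.filter_union_filter_not_eq _ _
    have hdis : Disjoint Y C := by
      rw [hY, hC]; exact (Finset.disjoint_filter_filter_not _ _ _).symm
    have hcard : Y.card + C.card = X.card := by rw [← Finset.card_union_of_disjoint hdis, hcup]
    have hYih := ih Y
    have hYih := fun hne => hYih hne (hz.mono hYX)
      (fun x hx => by
        have h1 := hc x (hYX hx)
        rw [hY, Finset.mem_filter] at hx
        omega)
      (fun x hx y hy => hnull x (hYX hx) y (hYX hy))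
    rcases C.eq_empty_or_nonempty with hCe | hCne
    · have hYX' : Y = X := by rw [← hcup, hCe, Finset.union_empty]
      obtain ⟨z, hzX, hz'⟩ := hYX' ▸ hYih (hYX' ▸ hX)
      exact ⟨z, hzX, by omega⟩
    · obtain ⟨t, htY, ht⟩ : ∃ t, Y.card + 1 ≤ t + m ∧ ∀ z ∈ C, t ≤ (backSums e Y z).ncard := by
        rcases Y.eq_empty_or_nonempty with hYe | hYne
        · refine ⟨1, by rw [hYe, Finset.card_empty]; omega, fun z _ => ?_⟩
          exact (Set.ncard_pos (backSums_finite e Y z)).2 ⟨0, zero_mem_backSums e Y z⟩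
        · obtain ⟨y, hy, hyt⟩ := hYih hYne
          refine ⟨_, hyt, fun z _ => ?_⟩
          have h1 := image_backSums_subset e (Finset.notMem_erase y Y) z
          rw [Finset.insert_erase hy] at h1
          have h2 := Set.ncard_le_ncard h1 (backSums_finite e Y z)
          rwa [Set.ncard_image_of_injective _ (add_left_injective (e y z))] at h2
      obtain ⟨z, hzC, hzt⟩ := exists_backSums_growth C Y t hdis hCne (hz.mono hCX)
        (fun x hx y hy hxy h0 => by
          refine hnull x (hCX hx) y (hCX hy) hxy h0 ?_
          rw [hC, Finset.mem_filter] at hx hy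
          rw [hx.2, hy.2]) ht
      rw [hcup] at hzt
      exact ⟨z, hCX hzC, by omega⟩

end Growth

/-! ### Colouring the pairs of cancelling opposite arcs -/

section Colouring

variable {V : Type*}

/-- Greedy colouring of a graph in which every nonempty set of vertices has a member with at most
`d` neighbours in the set. -/
lemma exists_colouring_of_degenerate [DecidableEq V] (N : V → V → Prop) [DecidableRel N]
    (hsymm : ∀ x y, N x y → N y x) (d : ℕ) :
    ∀ X : Finset V, (∀ Y ⊆ X, Y.Nonempty → ∃ v ∈ Y, (Y.filter (fun y => y ≠ v ∧ N y v)).card ≤ d) →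
      ∃ c : V → ℕ, (∀ x ∈ X, c x < d + 1) ∧ ∀ x ∈ X, ∀ y ∈ X, x ≠ y → N x y → c x ≠ c y := by
  intro X
  induction X using Finset.strongInduction with
  | H X ih =>
  intro hdeg
  rcases X.eq_empty_or_nonempty with rfl | hne
  · exact ⟨fun _ => 0, by simp, by simp⟩
  obtain ⟨v, hv, hvd⟩ := hdeg X subset_rfl hne
  obtain ⟨c, hc, hN⟩ := ih _ (Finset.erase_ssubset hv)
    (fun Y hY => hdeg Y (hY.trans (Finset.erase_subset _ _)))
  obtain ⟨i, hi, hic⟩ : ∃ i ∈ Finset.range (d + 1),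
      i ∉ (X.filter (fun y => y ≠ v ∧ N y v)).image c := by
    refine Finset.exists_mem_notMem_of_card_lt_card ?_
    rw [Finset.card_range]
    exact lt_of_le_of_lt Finset.card_image_le (by omega)
  have hcol : ∀ y ∈ X, y ≠ v → N y v → c y ≠ i := fun y hy hyv hNy h =>
    hic (Finset.mem_image.2 ⟨y, Finset.mem_filter.2 ⟨hy, hyv, hNy⟩, h⟩)
  refine ⟨Function.update c v i, fun x hx => ?_, fun x hx y hy hxy hNxy => ?_⟩
  · by_cases h : x = v
    · subst h; simpa using hi
    · rw [Function.update_of_ne h]; exact hc x (Finset.mem_erase.2 ⟨h, hx⟩)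
  · by_cases h : x = v
    · subst h
      rw [Function.update_self, Function.update_of_ne hxy.symm]
      exact (hcol y hy hxy.symm (hsymm _ _ hNxy)).symm
    · by_cases h' : y = v
      · subst h'
        rw [Function.update_self, Function.update_of_ne hxy]
        exact hcol x hx hxy hNxy
      · rw [Function.update_of_ne h, Function.update_of_ne h']
        exact hN x (Finset.mem_erase.2 ⟨h, hx⟩) y (Finset.mem_erase.2 ⟨h', hy⟩) hxy hNxy

/-- The first vertex of a longest path has all its neighbours on the path. -/
lemma exists_maximal_path (N : V → V → Prop)
    {Y : Finset V} (hY : Y.Nonempty) :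
    ∃ (v : V) (l : List V), (v :: l).Nodup ∧ (v :: l).IsChain N ∧ (∀ x ∈ v :: l, x ∈ Y) ∧
      ∀ y ∈ Y, N y v → y ∈ v :: l := by
  by_contra! hcon
  have hlong : ∀ n : ℕ, ∃ (v : V) (l : List V), (v :: l).Nodup ∧ (v :: l).IsChain N ∧
      (∀ x ∈ v :: l, x ∈ Y) ∧ l.length = n := by
    intro n
    induction n with
    | zero =>
      obtain ⟨v, hv⟩ := hY
      exact ⟨v, [], by simp, by simp, by simpa using hv, rfl⟩
    | succ n ih =>
      obtain ⟨v, l, h1, h2, h3, h4⟩ := ih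
      obtain ⟨y, hy, hyN, hyl⟩ := hcon v l h1 h2 h3
      refine ⟨y, v :: l, List.nodup_cons.2 ⟨hyl, h1⟩, List.isChain_cons_cons.2 ⟨hyN, h2⟩, ?_, ?_⟩
      · intro x hx
        rcases List.mem_cons.1 hx with rfl | hx
        · exact hy
        · exact h3 x hx
      · simp [h4]
  classical
  obtain ⟨v, l, h1, -, h3, h4⟩ := hlong Y.card
  have h5 := Finset.card_le_card (s := (v :: l).toFinset) (t := Y)
    (fun x hx => h3 x (List.mem_toFinset.1 hx))
  rw [List.toFinset_card_of_nodup h1, List.length_cons] at h5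
  omega

variable {A : Type*} [AddCommGroup A]

/-- Twice the weight of a path all of whose arcs cancel with their opposites is the difference of
the potential that witnesses reversibility. -/
lemma two_nsmul_pathWeight {w : V → V → A} {β : V → A} (hβ : ∀ x y, w x y - w y x = β y - β x)
    {a : V} {l : List V} {b : V}
    (hN : (a :: (l ++ [b])).IsChain (fun x y => w x y + w y x = 0)) :
    2 • pathWeight w a l b = β b - β a := by
  have key : ∀ x y, w x y + w y x = 0 → 2 • w x y = β y - β x := by
    intro x y h
    rw [← hβ x y, two_nsmul, sub_eq_add_neg, ← eq_neg_of_add_eq_zero_left h]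
  induction l generalizing a with
  | nil =>
    simp only [List.nil_append, List.isChain_cons_cons] at hN
    exact key a b hN.1
  | cons x l ih =>
    simp only [List.cons_append, List.isChain_cons_cons] at hN
    rw [pathWeight_cons, smul_add, ih hN.2, key a x hN.1]
    abel

/-- A path `v, l` of cancelling arcs, closed up by a further cancelling arc to its start, has
weight of order two. -/
lemma null_cycle_weight {w : V → V → A} (hrev : Reversible w) {T : Finset V} {K : AddSubgroup A}
    (hK : ∀ x ∈ T, ∀ y ∈ T, x ≠ y → w x y ∈ K) (hz : ZeroCycleFree w T) {v : V} {p : List V} {y : V}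
    (hp : p ≠ []) (hn : (v :: (p ++ [y])).Nodup) (hT : ∀ x ∈ v :: (p ++ [y]), x ∈ T)
    (hN : (v :: (p ++ [y])).IsChain (fun x y => w x y + w y x = 0)) (hyv : w y v + w v y = 0) :
    pathWeight w v (p ++ [y]) v ∈ K ∧ pathWeight w v (p ++ [y]) v ≠ 0 ∧
      2 • pathWeight w v (p ++ [y]) v = 0 := by
  obtain ⟨β, hβ⟩ := hrev
  have hv := (List.nodup_cons.1 hn).1
  have hvT := hT v (by simp)
  have hpT : ∀ x ∈ p ++ [y], x ∈ T := fun x hx => hT x (List.mem_cons_of_mem _ hx)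
  refine ⟨pathWeight_mem hK hvT hvT hpT (List.nodup_cons.1 hn).2 hv hv (by simp), ?_, ?_⟩
  · refine hz v hvT _ (List.nodup_cons.1 hn).2 hv hpT ?_
    have := List.length_pos_iff.2 hp
    rw [List.length_append, List.length_singleton]; omega
  · rw [two_nsmul_pathWeight hβ (a := v) (l := p ++ [y]) (b := v), sub_self]
    rw [← List.cons_append, List.isChain_append]
    refine ⟨hN, by simp, ?_⟩
    intro x hx z hz
    have hx' : x = y := by
      rw [← List.cons_append, List.getLast?_append] at hx
      simpa using hx.symm
    have hz' : z = v := by simpa using hz.symm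
    rw [hx', hz']; exact hyv

/-- If the weights lie in a group without elements of order two, then the graph of cancelling pairs
of arcs is a forest. -/
lemma exists_two_colouring {w : V → V → A} (hrev : Reversible w) {X : Finset V} {K : AddSubgroup A}
    (hK : ∀ x ∈ X, ∀ y ∈ X, x ≠ y → w x y ∈ K) (hz : ZeroCycleFree w X)
    (h2 : ∀ g ∈ K, 2 • g = 0 → g = 0) :
    ∃ c : V → ℕ, (∀ x ∈ X, c x < 2) ∧
      ∀ x ∈ X, ∀ y ∈ X, x ≠ y → w x y + w y x = 0 → c x ≠ c y := by
  classical
  refine exists_colouring_of_degenerate (fun x y => w x y + w y x = 0)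
    (fun x y h => by rw [add_comm]; exact h) 1 X fun Y hYX hY => ?_
  obtain ⟨v, l, hn, hN, hl, hmax⟩ := exists_maximal_path (fun x y => w x y + w y x = 0) hY
  refine ⟨v, hl v (by simp), Finset.card_le_one.2 ?_⟩
  have hhead : ∀ y ∈ Y.filter (fun y => y ≠ v ∧ w y v + w v y = 0), l.head? = some y := by
    intro y hy
    rw [Finset.mem_filter] at hy
    obtain ⟨hyY, hyv, hyN⟩ := hy
    have hyl : y ∈ l := (List.mem_cons.1 (hmax y hyY hyN)).resolve_left hyv
    obtain ⟨p, q, rfl⟩ := List.append_of_mem hyl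
    rcases p with _ | ⟨x, p⟩
    · rfl
    exfalso
    have hsub : (v :: (x :: p ++ [y])) <+: (v :: (x :: p ++ y :: q)) := ⟨q, by simp⟩
    obtain ⟨h1, h3, h4⟩ := null_cycle_weight hrev hK hz (by simp) (hn.sublist hsub.sublist)
      (fun x hx => hYX (hl x (hsub.subset hx))) (hN.prefix hsub) hyN
    exact h3 (h2 _ h1 h4)
  intro y hy z hz
  have h := (hhead y hy).symm.trans (hhead z hz)
  exact Option.some.inj h

/-- If the weights lie in a group with at most one element of order two, then the first vertex of a
longest path of cancelling arcs is not joined to three vertices of the path: otherwise there would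
be three cycles of order two, one of which has the difference of the weights of the two others. -/
lemma exists_three_colouring {w : V → V → A} (hrev : Reversible w) {X : Finset V}
    {K : AddSubgroup A}
    (hK : ∀ x ∈ X, ∀ y ∈ X, x ≠ y → w x y ∈ K) (hz : ZeroCycleFree w X)
    (h2 : ∀ g ∈ K, ∀ h ∈ K, 2 • g = 0 → 2 • h = 0 → g ≠ 0 → h ≠ 0 → g = h) :
    ∃ c : V → ℕ, (∀ x ∈ X, c x < 3) ∧
      ∀ x ∈ X, ∀ y ∈ X, x ≠ y → w x y + w y x = 0 → c x ≠ c y := by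
  classical
  refine exists_colouring_of_degenerate (fun x y => w x y + w y x = 0)
    (fun x y h => by rw [add_comm]; exact h) 2 X fun Y hYX hY => ?_
  obtain ⟨v, l, hn, hN, hl, hmax⟩ := exists_maximal_path (fun x y => w x y + w y x = 0) hY
  refine ⟨v, hl v (by simp), ?_⟩
  by_contra! hcard
  have hmem : ∀ y ∈ Y.filter (fun y => y ≠ v ∧ w y v + w v y = 0), y ∈ l := by
    intro y hy
    rw [Finset.mem_filter] at hy
    exact (List.mem_cons.1 (hmax y hy.1 hy.2.2)).resolve_left hy.2.1
  rcases l with _ | ⟨x, l⟩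
  · obtain ⟨y, hy⟩ := Finset.card_pos.1 (Nat.zero_lt_of_lt hcard)
    exact absurd (hmem y hy) (by simp)
  have hcard' : 1 < ((Y.filter (fun y => y ≠ v ∧ w y v + w v y = 0)).erase x).card := by
    have := Finset.pred_card_le_card_erase (s := Y.filter (fun y => y ≠ v ∧ w y v + w v y = 0))
      (a := x)
    omega
  obtain ⟨y, z, hy, hz', hyz⟩ := Finset.one_lt_card_iff.1 hcard'
  obtain ⟨y, z, p, q, s, hyN, hzN, hl'⟩ : ∃ (y z : V) (p q s : List V), w y v + w v y = 0 ∧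
      w z v + w v z = 0 ∧ l = p ++ y :: (q ++ z :: s) := by
    rw [Finset.mem_erase] at hy hz'
    have hyl := (List.mem_cons.1 (hmem y hy.2)).resolve_left hy.1
    have hzl := (List.mem_cons.1 (hmem z hz'.2)).resolve_left hz'.1
    have hyN := (Finset.mem_filter.1 hy.2).2.2
    have hzN := (Finset.mem_filter.1 hz'.2).2.2
    obtain ⟨p, q, rfl⟩ := List.append_of_mem hyl
    rcases List.mem_append.1 hzl with h | h
    · obtain ⟨p, q', rfl⟩ := List.append_of_mem h
      exact ⟨z, y, p, q', q, hzN, hyN, by simp⟩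
    · obtain ⟨q, s, rfl⟩ := List.append_of_mem ((List.mem_cons.1 h).resolve_left hyz.symm)
      exact ⟨y, z, p, q, s, hyN, hzN, rfl⟩
  subst hl'
  have hsub1 : (v :: (x :: p ++ [y])) <+: (v :: x :: (p ++ y :: (q ++ z :: s))) :=
    ⟨q ++ z :: s, by simp⟩
  have hsub2 : (v :: (x :: p ++ y :: q ++ [z])) <+: (v :: x :: (p ++ y :: (q ++ z :: s))) :=
    ⟨s, by simp⟩
  obtain ⟨h11, h12, h13⟩ := null_cycle_weight hrev hK hz (by simp) (hn.sublist hsub1.sublist)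
      (fun x hx => hYX (hl x (hsub1.subset hx))) (hN.prefix hsub1) hyN
  obtain ⟨h21, h22, h23⟩ := null_cycle_weight hrev hK hz (by simp) (hn.sublist hsub2.sublist)
      (fun x hx => hYX (hl x (hsub2.subset hx))) (hN.prefix hsub2) hzN
  have heq := h2 _ h11 _ h21 h13 h23 h12 h22
  have hsub3 : (v :: y :: (q ++ [z])).Sublist (v :: x :: (p ++ y :: (q ++ z :: s))) := by
    refine List.Sublist.cons_cons v ?_
    refine List.Sublist.cons x (List.Sublist.trans ?_ (List.sublist_append_right p _))
    exact List.Sublist.cons_cons y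
      (List.Sublist.append_left (List.Sublist.cons_cons z (List.nil_sublist s)) q)
  have hn3 := List.nodup_cons.1 (hn.sublist hsub3)
  refine hz v (hYX (hl v (by simp))) (y :: (q ++ [z])) hn3.2 hn3.1
    (fun u hu => hYX (hl u (hsub3.subset (List.mem_cons_of_mem _ hu)))) (by simp) ?_
  rw [List.append_assoc] at heq
  have heq' : pathWeight w v (x :: p ++ y :: []) v = pathWeight w v (x :: p ++ y :: (q ++ [z])) v :=
    heq
  rw [pathWeight_append, pathWeight_append] at heq'
  have h4 : w v y + w y v = 0 := by rw [add_comm]; exact hyN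
  rw [pathWeight_cons, ← add_left_cancel heq']
  exact h4

end Colouring

/-! ### Sets that are almost stable under translations -/

section AlmostStable

variable {A : Type*} [AddCommGroup A] [Finite A]

lemma add_mem_of_stable {P D : Set A}
    (h : ∀ δ ∈ D, (∀ x ∈ P, x + δ ∈ P) ∨ ∀ x ∈ P, x - δ ∈ P) {g : A}
    (hg : g ∈ AddSubgroup.closure D) : ∀ x ∈ P, x + g ∈ P := by
  have hneg : ∀ g : A, (∀ x ∈ P, x + g ∈ P) → ∀ x ∈ P, x + -g ∈ P := by
    intro g hg
    have hmul : ∀ n : ℕ, ∀ x ∈ P, x + n • g ∈ P := by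
      intro n
      induction n with
      | zero => intro x hx; simpa using hx
      | succ n ih =>
        intro x hx
        rw [succ_nsmul, ← add_assoc]
        exact hg _ (ih x hx)
    obtain ⟨n, hn⟩ := AddSubmonoid.mem_multiples_iff _ _ |>.1
      (mem_multiples_iff_mem_zmultiples.2
        (AddSubgroup.neg_mem _ (AddSubgroup.mem_zmultiples g)))
    intro x hx
    rw [← hn]
    exact hmul n x hx
  induction hg using AddSubgroup.closure_induction with
  | mem δ hδ =>
    rcases h δ hδ with h | h
    · exact h
    · have := hneg (-δ) (fun x hx => by rw [← sub_eq_add_neg]; exact h x hx)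
      simpa using this
  | zero => intro x hx; simpa using hx
  | add g g' _ _ hg hg' =>
    intro x hx
    rw [← add_assoc]
    exact hg' _ (hg x hx)
  | neg g _ hg => exact hneg g hg

/-- The case of `exists_arithmetic_progression` in which a generator that moves some `e ∈ R` out of
`R` generates the whole group. -/
lemma arithmetic_progression_of_cyclic {D R : Set A} {d e : A} (hD : ∀ δ ∈ D, ∃ j : ℕ, δ = j • d)
    (hRd : ∀ x ∈ R, ∃ i : ℕ, x = e + i • d) (hR : R.Nontrivial)
    (hcard : R.ncard + 2 ≤ addOrderOf d) (heR : e ∈ R) (hed : e - d ∉ R)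
    (hsub : ∀ x ∈ R, ∀ y ∈ R, x - d ∉ R → y - d ∉ R → x = y)
    (hadd : ∀ δ ∈ D, ∀ x ∈ R, ∀ y ∈ R, x + δ ∉ R → y + δ ∉ R → x = y) :
    (∀ δ ∈ D, δ = 0 ∨ δ = d ∨ δ = -d) ∧ R = (fun i : ℕ => e + i • d) '' Set.Iio R.ncard := by
  classical
  obtain ⟨q, hq⟩ : ∃ q, q = addOrderOf d := ⟨_, rfl⟩
  have hq0 : q • d = 0 := hq ▸ addOrderOf_nsmul_eq_zero d
  have hqpos : 0 < q := by omega
  have hlt : ∀ g : A, (∃ j : ℕ, g = j • d) → ∃ j < q, g = j • d := by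
    rintro g ⟨j, rfl⟩
    exact ⟨j % q, Nat.mod_lt _ hqpos, by rw [hq, mod_addOrderOf_nsmul]⟩
  have hinj : ∀ i < q, ∀ j < q, i • d = j • d → i = j := by
    intro i hi j hj h
    rw [hq] at hi hj
    exact nsmul_injOn_Iio_addOrderOf hi hj h
  have hex : ∃ i : ℕ, e + i • d ∉ R := by
    refine ⟨q - 1, ?_⟩
    have : (q - 1) • d = -d := by
      rw [eq_neg_iff_add_eq_zero, ← succ_nsmul, Nat.sub_add_cancel hqpos, hq0]
    rwa [this, ← sub_eq_add_neg]
  obtain ⟨r, hr⟩ : ∃ r, r = Nat.find hex := ⟨_, rfl⟩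
  have hin : ∀ i < r, e + i • d ∈ R := fun i hi => by
    by_contra h
    exact Nat.find_min hex (hr ▸ hi) h
  have hout : ∀ i, r ≤ i → i < q → e + i • d ∉ R := by
    intro i hi
    induction i, hi using Nat.le_induction with
    | base => intro _; rw [hr]; exact Nat.find_spec hex
    | succ i hi ih =>
      intro hiq h
      have h1 : e + (i + 1) • d - d = e + i • d := by rw [succ_nsmul]; abel
      have h2 := hsub _ h e heR (h1 ▸ ih (by omega)) hed
      have h3 : (i + 1) • d = 0 • d := by rw [zero_nsmul]; simpa using h2
      have := hinj _ hiq _ hqpos h3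
      omega
  have hrq : r ≤ q := by
    by_contra h
    have h1 := hin (q - 1) (by omega)
    have : (q - 1) • d = -d := by
      rw [eq_neg_iff_add_eq_zero, ← succ_nsmul, Nat.sub_add_cancel hqpos, hq0]
    rw [this, ← sub_eq_add_neg] at h1
    exact hed h1
  have hRr : R = (fun i : ℕ => e + i • d) '' Set.Iio r := by
    ext x
    constructor
    · intro hx
      obtain ⟨i, hi⟩ := hRd x hx
      obtain ⟨j, hj, hij⟩ := hlt (i • d) ⟨i, rfl⟩
      rw [hij] at hi
      refine ⟨j, ?_, hi.symm⟩
      by_contra h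
      exact hout j (not_lt.1 h) hj (hi ▸ hx)
    · rintro ⟨i, hi, rfl⟩
      exact hin i hi
  have hcardr : R.ncard = r := by
    rw [hRr, Set.InjOn.ncard_image, ← Finset.coe_Iio, Set.ncard_coe_finset, Nat.card_Iio]
    intro i hi j hj h
    exact hinj i (lt_of_lt_of_le hi hrq) j (lt_of_lt_of_le hj hrq) (add_left_cancel h)
  refine ⟨fun δ hδ => ?_, by rw [hcardr]; exact hRr⟩
  have hr2 : 2 ≤ r := by
    rw [← hcardr]
    exact (Set.one_lt_ncard_iff_nontrivial_and_finite.2 ⟨hR, Set.toFinite R⟩)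
  obtain ⟨j, hj, rfl⟩ := hlt δ (hD δ hδ)
  rcases Nat.eq_zero_or_pos j with rfl | hj0
  · exact Or.inl (zero_nsmul d)
  rcases eq_or_ne j 1 with rfl | hj1
  · exact Or.inr (Or.inl (one_nsmul d))
  rcases eq_or_ne (j + 1) q with hjq | hjq
  · refine Or.inr (Or.inr ?_)
    rw [eq_neg_iff_add_eq_zero, ← succ_nsmul, hjq, hq0]
  exfalso
  -- Two neighbouring terms of the progression are both moved out of it.
  obtain ⟨i, hir, hij, hijq⟩ : ∃ i, i + 1 < r ∧ r ≤ i + j ∧ i + j + 1 < q := by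
    by_cases h : j ≤ r
    · exact ⟨r - j, by omega, by omega, by omega⟩
    · exact ⟨0, by omega, by omega, by omega⟩
  have h1 := hadd _ hδ _ (hin i (by omega)) _ (hin (i + 1) hir)
    (by rw [add_assoc, ← add_nsmul]; exact hout _ hij (by omega))
    (by rw [add_assoc, ← add_nsmul]; exact hout _ (by omega) (by omega))
  have := hinj _ (by omega) _ (by omega) (add_left_cancel h1)
  omega

/-- A set `R` in a finite abelian group `K`, of size between `2` and `|K| - 2`, such that for every
member `δ` of a generating set of `K` at most one element of `R` is moved out of `R` by `-δ` and
at most one by `+δ`, is an arithmetic progression, and the generators are `0` or the difference of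
the progression up to sign. -/
theorem exists_arithmetic_progression {K : AddSubgroup A} {D R : Set A}
    (hD : AddSubgroup.closure D = K) (hRK : R ⊆ K) (hR : R.Nontrivial)
    (hcard : R.ncard + 2 ≤ Nat.card K)
    (hsub : ∀ δ ∈ D, ∀ x ∈ R, ∀ y ∈ R, x - δ ∉ R → y - δ ∉ R → x = y)
    (hadd : ∀ δ ∈ D, ∀ x ∈ R, ∀ y ∈ R, x + δ ∉ R → y + δ ∉ R → x = y) :
    ∃ d e : A, AddSubgroup.zmultiples d = K ∧ (∀ δ ∈ D, δ = 0 ∨ δ = d ∨ δ = -d) ∧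
      R = (fun i : ℕ => e + i • d) '' Set.Iio R.ncard := by
  have hDK : ∀ δ ∈ D, δ ∈ K := fun δ hδ => hD ▸ AddSubgroup.subset_closure hδ
  -- A set that is stable under the generators is a union of cosets of `K`.
  have hfull : ∀ P : Set A, (∀ δ ∈ D, (∀ x ∈ P, x + δ ∈ P) ∨ ∀ x ∈ P, x - δ ∈ P) → P.Nonempty →
      Nat.card K ≤ P.ncard := by
    rintro P hP ⟨x, hx⟩
    have h1 : (fun g => x + g) '' (K : Set A) ⊆ P := by
      rintro _ ⟨g, hg, rfl⟩
      exact add_mem_of_stable hP (hD ▸ hg) x hx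
    have h2 := Set.ncard_le_ncard h1 (Set.toFinite P)
    rwa [Set.ncard_image_of_injective _ (add_right_injective x)] at h2
  obtain ⟨d, hdD, e, heR, hed⟩ : ∃ d ∈ D, ∃ e ∈ R, e - d ∉ R := by
    by_contra! h
    have := hfull R (fun δ hδ => Or.inr (h δ hδ)) hR.nonempty
    omega
  have hd0 : d ≠ 0 := fun h => hed (by rwa [h, sub_zero])
  obtain ⟨L, hL⟩ : ∃ L, L = AddSubgroup.zmultiples d := ⟨_, rfl⟩
  have hdL : d ∈ L := hL ▸ AddSubgroup.mem_zmultiples d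
  -- `R` meets every coset of `L` other than `e + L` in the whole coset or not at all.
  have hcoset : ∀ x ∈ R, x - e ∉ L → ∀ g ∈ L, x + g ∈ R := by
    intro x hx hxe g hg
    have := add_mem_of_stable (P := {y | y ∈ R ∧ y - e ∉ L}) (D := {d}) (g := g) ?_ ?_ x ⟨hx, hxe⟩
    · exact this.1
    · rintro _ rfl
      refine Or.inr fun y hy => ⟨?_, fun h => hy.2 ?_⟩
      · by_contra h
        refine hy.2 ?_
        rw [hsub _ hdD y hy.1 e heR h hed, sub_self]
        exact L.zero_mem
      · have := L.add_mem h hdL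
        rwa [sub_right_comm, sub_add_cancel] at this
    · rwa [← AddSubgroup.zmultiples_eq_closure, ← hL]
  obtain ⟨f, hf⟩ : ∃ f, f = e - d := ⟨_, rfl⟩
  have hfR : f ∉ R := hf ▸ hed
  -- The case of a generator outside `L` that moves `e` inside `R`.
  have hstable : ∀ δ ∈ D, δ ∉ L → e - δ ∈ R → ∀ x ∈ insert f R, x + δ ∈ insert f R := by
    intro δ hδ hδL heδ
    have h1 : f - δ ∈ R := by
      have := hcoset _ heδ (fun h => hδL (by
        have := L.neg_mem h; rwa [show -(e - δ - e) = δ by abel] at this)) (-d) (L.neg_mem hdL)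
      rwa [show e - δ + -d = f - δ by rw [hf]; abel] at this
    have h2 : ∀ x ∈ R, x + δ ∉ R → x = f - δ := fun x hx h =>
      hadd δ hδ x hx _ h1 h (by rwa [sub_add_cancel])
    intro x hx
    rcases hx with rfl | hx
    · by_contra h
      rw [Set.mem_insert_iff, not_or] at h
      have h3 : e + δ ∉ R := by
        intro h3
        have := hcoset _ h3 (by rwa [add_sub_cancel_left]) (-d) (L.neg_mem hdL)
        rw [show e + δ + -d = x + δ by rw [hf]; abel] at this
        exact h.2 this
      have h4 := h2 e heR h3
      rw [hf] at h4
      have h5 : δ = -d := by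
        have : e + δ = e + -d := by
          calc e + δ = (e - d - δ) + δ := by rw [← h4]
            _ = e + -d := by abel
        exact add_left_cancel this
      exact hδL (h5 ▸ L.neg_mem hdL)
    · by_cases h : x + δ ∈ R
      · exact Or.inr h
      · rw [h2 x hx h, sub_add_cancel]; exact Or.inl rfl
  by_cases hDL : ∀ δ ∈ D, δ ∈ L
  · have hLK : L = K := by
      refine le_antisymm ?_ ?_
      · rw [hL, AddSubgroup.zmultiples_le]; exact hDK d hdD
      · rw [← hD, AddSubgroup.closure_le]; exact hDL
    have hmul : ∀ g ∈ L, ∃ j : ℕ, g = j • d := by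
      intro g hg
      rw [hL, ← mem_multiples_iff_mem_zmultiples] at hg
      obtain ⟨j, hj⟩ := (AddSubmonoid.mem_multiples_iff _ _).1 hg
      exact ⟨j, hj.symm⟩
    refine ⟨d, e, hL ▸ hLK, arithmetic_progression_of_cyclic (fun δ hδ => hmul δ (hDL δ hδ)) ?_ hR
      ?_ heR hed (hsub d hdD) hadd⟩
    · intro x hx
      obtain ⟨i, hi⟩ := hmul (x - e) (hLK ▸ K.sub_mem (hRK hx) (hRK heR))
      exact ⟨i, by rw [← hi, add_sub_cancel]⟩
    · rwa [← Nat.card_zmultiples, ← hL, hLK]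
  exfalso
  push Not at hDL
  by_cases hB : ∃ δ ∈ D, δ ∉ L ∧ e - δ ∉ R
  · -- Here `R` meets `e + L` in `e` alone, and the rest of `R` is stable.
    obtain ⟨d', hd'D, hd'L, hed'⟩ := hB
    have hB : ∀ x ∈ R, x - e ∈ L → x = e := by
      intro x hx hxe
      refine hsub d' hd'D x hx e heR (fun h => hed' ?_) hed'
      have := hcoset _ h (fun h' => hd'L ?_) (e - x) (by
        have := L.neg_mem hxe; rwa [neg_sub] at this)
      · rwa [show x - d' + (e - x) = e - d' by abel] at this
      · have := L.sub_mem hxe h'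
        rwa [show x - e - (x - d' - e) = d' by abel] at this
    have hP : ∀ δ ∈ D, ∀ x ∈ R \ {e}, x - δ ∈ R \ {e} := by
      rintro δ hδ x ⟨hx, hxe⟩
      rw [Set.mem_singleton_iff] at hxe
      have hxL : x - e ∉ L := fun h => hxe (hB x hx h)
      by_cases hδL : δ ∈ L
      · refine ⟨?_, fun h => hxL ?_⟩
        · rw [sub_eq_add_neg]; exact hcoset x hx hxL _ (L.neg_mem hδL)
        · rw [Set.mem_singleton_iff] at h
          rwa [← h, sub_sub_cancel]
      by_cases heδ : e - δ ∈ R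
      · exfalso
        have h1 : e - δ - d' ∈ R := by
          by_contra h
          have := hsub d' hd'D _ heδ e heR h hed'
          rw [sub_eq_self] at this
          exact hδL (this ▸ L.zero_mem)
        have h2 := hstable δ hδ hδL heδ _ (Or.inr h1)
        rw [show e - δ - d' + δ = e - d' by abel] at h2
        rcases h2 with h2 | h2
        · rw [hf, sub_right_inj] at h2
          exact hd'L (h2 ▸ hdL)
        · exact hed' h2
      · refine ⟨?_, fun h => ?_⟩
        · by_contra h
          exact hxe (hsub δ hδ x hx e heR h heδ)
        · rw [Set.mem_singleton_iff] at h
          have h1 := hcoset x hx hxL d hdL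
          have h2 : x + d - δ ∉ R := by
            rw [show x + d - δ = e + d by rw [← h]; abel]
            intro h3
            have := hB _ h3 (by rwa [add_sub_cancel_left])
            exact hd0 (by simpa using this)
          have h3 := hsub δ hδ _ h1 e heR h2 heδ
          refine hxL ?_
          rw [← h3, sub_add_cancel_left]
          exact L.neg_mem hdL
    obtain ⟨x, hx, hxe⟩ := hR.exists_ne e
    have := add_mem_of_stable (g := e - x) (fun δ hδ => Or.inr (hP δ hδ))
      (hD ▸ K.sub_mem (hRK heR) (hRK hx)) x ⟨hx, hxe⟩
    rw [add_sub_cancel] at this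
    exact this.2 rfl
  · -- Here `e + L` lies in `R` up to the element `f`, and `insert f R` is stable.
    push Not at hB
    obtain ⟨d', hd'D, hd'L⟩ := hDL
    have hcos : ∀ g ∈ L, e + g ∈ insert f R := by
      have hin : ∀ g ∈ L, e + g - d' ∈ R := by
        intro g hg
        have := hcoset _ (hB d' hd'D hd'L) (fun h => hd'L (by
          have := L.neg_mem h; rwa [show -(e - d' - e) = d' by abel] at this)) g hg
        rwa [show e - d' + g = e + g - d' by abel] at this
      intro g hg
      by_cases h : e + g ∈ R
      · exact Or.inr h
      · have := hadd d' hd'D _ (hin g hg) _ (hin (-d) (L.neg_mem hdL)) (by rwa [sub_add_cancel])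
          (by rwa [sub_add_cancel, ← sub_eq_add_neg])
        rw [sub_left_inj, ← sub_eq_add_neg, ← hf] at this
        exact Or.inl this
    have := hfull (insert f R) (fun δ hδ => Or.inl ?_) ⟨f, Or.inl rfl⟩
    · have h1 := Set.ncard_insert_le f R
      omega
    by_cases hδL : δ ∈ L
    · intro x hx
      by_cases hxL : x - e ∈ L
      · have := hcos _ (L.add_mem hxL hδL)
        rwa [show e + (x - e + δ) = x + δ by abel] at this
      · rcases hx with rfl | hx
        · exact absurd (by rw [hf, sub_sub_cancel_left]; exact L.neg_mem hdL) hxL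
        · exact Or.inr (hcoset x hx hxL δ hδL)
    · exact hstable δ hδ hδL (hB δ hδ hδL)

end AlmostStable

/-! ### Path sums confined to a window of integers -/

section Window

variable {V A : Type*} [AddCommGroup A]

lemma backSum_eq_zsmul {δ : V → V → A} {ε : V → V → ℤ} {d : A} {S : Finset V}
    (hε : ∀ x ∈ S, ∀ y ∈ S, x ≠ y → δ x y = ε x y • d) {b : V} {l : List V} (hl : (b :: l).Nodup)
    (hS : ∀ x ∈ b :: l, x ∈ S) : backSum δ b l = backSum ε b l • d := by
  induction l generalizing b with
  | nil => simp
  | cons x l ih =>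
    rw [List.nodup_cons] at hl
    rw [backSum_cons, backSum_cons, ih hl.2 (fun y hy => hS y (List.mem_cons_of_mem _ hy)),
      hε x (hS x (by simp)) b (hS b (by simp)) (fun h => hl.1 (by simp [h])), add_smul]

/-- If all values `μ - backSum δ z l` lie in an arithmetic progression whose length is at most its
period minus two, and if every arc contributes at most one step, then the number of steps stays in
a window of integers of the length of the progression. -/
lemma ncard_backSums_le [DecidableEq V] {δ : V → V → A} {ε : V → V → ℤ} {d e μ : A} {S : Finset V}
    {z : V} {r : ℕ} (hz : z ∈ S) (hr : r + 2 ≤ addOrderOf d) (hε1 : ∀ x y, |ε x y| ≤ 1)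
    (hε : ∀ x ∈ S, ∀ y ∈ S, x ≠ y → δ x y = ε x y • d)
    (hμ : ∀ l : List V, l.Nodup → (∀ x ∈ l, x ∈ S.erase z) →
      μ - backSum δ z l ∈ (fun i : ℕ => e + i • d) '' Set.Iio r) :
    (backSums ε (S.erase z) z).ncard ≤ r := by
  obtain ⟨i, hi, hiμ⟩ := hμ [] (by simp) (by simp)
  simp only [backSum_nil, sub_zero] at hiμ
  have key : ∀ l : List V, l.Nodup → (∀ x ∈ l, x ∈ S.erase z) →
      ∃ j : ℕ, j < r ∧ (i : ℤ) - j = backSum ε z l := by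
    intro l
    induction l using List.reverseRecOn with
    | nil => intro _ _; exact ⟨i, hi, by simp⟩
    | append_singleton l x ih =>
      intro hl hS
      obtain ⟨j, hj, hjl⟩ := ih (hl.sublist (List.sublist_append_left _ _))
        (fun y hy => hS y (List.mem_append_left _ hy))
      obtain ⟨y, hy⟩ := exists_backSum_append_singleton ε z l x
      obtain ⟨j', hj', hjμ⟩ := hμ _ hl hS
      refine ⟨j', hj', ?_⟩
      rw [backSum_eq_zsmul hε (List.nodup_cons.2 ⟨fun h => Finset.ne_of_mem_erase (hS z h) rfl, hl⟩)
        (by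
          intro u hu
          rcases List.mem_cons.1 hu with rfl | hu
          · exact hz
          · exact Finset.mem_of_mem_erase (hS u hu)), ← hiμ] at hjμ
      have h0 : ((i : ℤ) - j' - backSum ε z (l ++ [x])) • d = 0 := by
        rw [sub_smul, sub_smul, natCast_zsmul, natCast_zsmul]
        have : j' • d = i • d - backSum ε z (l ++ [x]) • d := by
          rw [← add_right_inj e]
          simp only at hjμ
          rw [hjμ]; abel
        rw [this]; abel
      have hdvd := addOrderOf_dvd_iff_zsmul_eq_zero.2 h0
      have h1 := abs_le.1 (hε1 x y)
      have hi' : i < r := hi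
      have hj'' : j' < r := hj'
      have habs : |(i : ℤ) - j' - backSum ε z (l ++ [x])| < addOrderOf d := by
        rw [abs_lt, hy, ← hjl]
        constructor <;> omega
      have := Int.eq_zero_of_abs_lt_dvd hdvd habs
      omega
  have hsub : backSums ε (S.erase z) z ⊆ (fun j : ℕ => (i : ℤ) - j) '' Set.Iio r := by
    rintro g ⟨l, hl, hS, rfl⟩
    obtain ⟨j, hj, hjl⟩ := key l hl hS
    exact ⟨j, hj, hjl⟩
  have h1 := Set.ncard_le_ncard hsub ((Set.finite_Iio r).image _)
  have h2 := Set.ncard_image_le (f := fun j : ℕ => (i : ℤ) - j) (Set.finite_Iio r)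
  rw [← Finset.coe_Iio, Set.ncard_coe_finset, Nat.card_Iio] at h2
  rw [← Finset.coe_Iio] at h1
  exact h1.trans h2

lemma eq_of_two_nsmul_eq_zero {d g h : A} (hg : g ∈ AddSubgroup.zmultiples d)
    (hh : h ∈ AddSubgroup.zmultiples d) (hg2 : 2 • g = 0) (hh2 : 2 • h = 0) (hg0 : g ≠ 0)
    (hh0 : h ≠ 0) : g = h := by
  obtain ⟨i, rfl⟩ := AddSubgroup.mem_zmultiples_iff.1 hg
  obtain ⟨j, rfl⟩ := AddSubgroup.mem_zmultiples_iff.1 hh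
  have key : ∀ i : ℤ, 2 • i • d = 0 → i • d ≠ 0 → ∃ m : ℤ, 2 * i = addOrderOf d * (2 * m + 1) := by
    intro i h2 h0
    have h3 : (2 * i) • d = 0 := by rw [mul_smul]; exact_mod_cast h2
    obtain ⟨m, hm⟩ := addOrderOf_dvd_iff_zsmul_eq_zero.2 h3
    rcases Int.even_or_odd' m with ⟨m, rfl | rfl⟩
    · exfalso
      refine h0 (addOrderOf_dvd_iff_zsmul_eq_zero.1 ⟨m, ?_⟩)
      linarith
    · exact ⟨m, hm⟩
  obtain ⟨m, hm⟩ := key i hg2 hg0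
  obtain ⟨m', hm'⟩ := key j hh2 hh0
  rw [← sub_eq_zero, ← sub_smul]
  exact addOrderOf_dvd_iff_zsmul_eq_zero.1 ⟨m - m', by linarith⟩

/-- If path weights are confined to an arithmetic progression of length `r` that misses at least two
elements of `K`, then integral path sums are confined to a window of length `r`; with at least
`r + 2 Ω(|K|)` vertices this is incompatible with the growth of the sets of path sums. -/
lemma window_contradiction [Finite V] [DecidableEq V] {δ : V → V → A} {K : AddSubgroup A}
    {d e : A} {S : Finset V} {r : ℕ} (hdK : AddSubgroup.zmultiples d = K) (hr2 : 2 ≤ r)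
    (hr : r + 2 ≤ Nat.card K) (hrev : Reversible δ) (hz : ZeroCycleFree δ S)
    (hδ : ∀ x ∈ S, ∀ y ∈ S, x ≠ y → δ x y = 0 ∨ δ x y = d ∨ δ x y = -d)
    (hS : r + 2 * ArithmeticFunction.cardFactors (Nat.card K) ≤ S.card) (μ : V → A)
    (hμ : ∀ z ∈ S, ∀ l : List V, l.Nodup → (∀ x ∈ l, x ∈ S.erase z) →
      μ z - backSum δ z l ∈ (fun i : ℕ => e + i • d) '' Set.Iio r) : False := by
  have hcard : Nat.card K = addOrderOf d := by rw [← hdK, Nat.card_zmultiples]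
  have hdK' : d ∈ K := hdK ▸ AddSubgroup.mem_zmultiples d
  have hex : ∀ x y, ∃ n : ℤ, |n| ≤ 1 ∧ (x ∈ S → y ∈ S → x ≠ y → δ x y = n • d) := by
    intro x y
    by_cases h : x ∈ S ∧ y ∈ S ∧ x ≠ y
    · rcases hδ x h.1 y h.2.1 h.2.2 with h | h | h
      · exact ⟨0, by simp, by simp [h]⟩
      · exact ⟨1, by simp, by simp [h]⟩
      · exact ⟨-1, by simp, by simp [h]⟩
    · exact ⟨0, by simp, fun h1 h2 h3 => absurd ⟨h1, h2, h3⟩ h⟩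
  choose ε hε1 hε using hex
  have hε' : ∀ x ∈ S, ∀ y ∈ S, x ≠ y → δ x y = ε x y • d := fun x hx y hy h => hε x y hx hy h
  have hδK : ∀ x ∈ S, ∀ y ∈ S, x ≠ y → δ x y ∈ K := fun x hx y hy h => by
    rw [hε' x hx y hy h]; exact K.zsmul_mem hdK' _
  have hεz : ZeroCycleFree ε S := by
    intro a ha l hl hal hlS h2 h0
    refine hz a ha l hl hal hlS h2 ?_
    have := pathWeight_rel (P := fun (g : A) (n : ℤ) => g = n • d)
      (fun g n g' n' h h' => by rw [h, h', add_smul]) hε' ha ha hlS hl hal hal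
      (fun _ h => by simp [h] at h2)
    rw [this, h0, zero_smul]
  have hne : S.Nonempty := Finset.card_pos.1 (by omega)
  have hle : ∀ z ∈ S, (backSums ε (S.erase z) z).ncard ≤ r := fun z hz =>
    ncard_backSums_le hz (hcard ▸ hr) hε1 hε' (hμ z hz)
  have hnull : ∀ x ∈ S, ∀ y ∈ S, x ≠ y → ε x y + ε y x = 0 → δ x y + δ y x = 0 := by
    intro x hx y hy hxy h
    rw [hε' x hx y hy hxy, hε' y hy x hx hxy.symm, ← add_smul, h, zero_smul]
  have hΩ0 : ArithmeticFunction.cardFactors (Nat.card K) ≠ 0 := by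
    rw [Ne, ArithmeticFunction.cardFactors_eq_zero_iff_eq_zero_or_one]; omega
  by_cases hp : (Nat.card K).Prime
  · obtain ⟨c, hc, hcN⟩ := exists_two_colouring hrev hδK hz (by
      intro g hg hg2
      have h1 : addOrderOf g ∣ 2 := addOrderOf_dvd_of_nsmul_eq_zero hg2
      have h2 : addOrderOf g ∣ Nat.card K := by
        rw [hcard]; rw [← hdK] at hg; exact addOrderOf_dvd_of_mem_zmultiples hg
      have h3 : Nat.Coprime 2 (Nat.card K) :=
        (Nat.coprime_primes Nat.prime_two hp).2 (by omega)
      exact AddMonoid.addOrderOf_eq_one_iff.1 (Nat.eq_one_of_dvd_coprimes h3 h1 h2))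
    obtain ⟨z, hzS, hcardz⟩ := exists_card_le_backSums c 2 S hne hεz hc
      (fun x hx y hy hxy h => hcN x hx y hy hxy (hnull x hx y hy hxy h))
    have := hle z hzS
    omega
  · have hΩ1 : ArithmeticFunction.cardFactors (Nat.card K) ≠ 1 := by
      rwa [Ne, ArithmeticFunction.cardFactors_eq_one_iff_prime]
    obtain ⟨c, hc, hcN⟩ := exists_three_colouring hrev hδK hz (by
      intro g hg h hh
      rw [← hdK] at hg hh
      exact eq_of_two_nsmul_eq_zero hg hh)
    obtain ⟨z, hzS, hcardz⟩ := exists_card_le_backSums c 3 S hne hεz hc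
      (fun x hx y hy hxy h => hcN x hx y hy hxy (hnull x hx y hy hxy h))
    have := hle z hzS
    omega

end Window

/-! ### The number of path weights and the number of vertices -/

lemma eq_of_mem_diff_of_ncard_le {A : Type*} [Finite A] {P Q : Set A} (hQ : Q ⊆ P)
    (hcard : P.ncard ≤ Q.ncard + 1) {x y : A} (hx : x ∈ P) (hy : y ∈ P)
    (hxQ : x ∉ Q) (hyQ : y ∉ Q) : x = y := by
  have h1 := Set.ncard_sdiff_add_ncard_of_subset hQ
  exact (Set.ncard_le_one (Set.toFinite (P \ Q))).1 (by omega) x ⟨hx, hxQ⟩ y ⟨hy, hyQ⟩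

section Main

variable {V A : Type*} [AddCommGroup A]

lemma pathWeight_reverse_eq_sub_backSum (w : V → V → A) (a z : V) (l : List V) :
    pathWeight w a l.reverse z = w a z - backSum (defect (w a) w) z l := by
  induction l generalizing z with
  | nil => simp
  | cons x l ih =>
    rw [List.reverse_cons, pathWeight_append, ih, backSum_cons, pathWeight_nil, defect]
    abel

open scoped ArithmeticFunction.Omega

/-- Path weights are numerous: without zero cycles, the paths from `a` to `b` through a nonempty set
`S` have at least `min (|K| - 1) (|S| + 1 - 2 Ω(|K|))` different weights. -/
def ManyPathWeights (V : Type*) (K : AddSubgroup A) : Prop :=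
  ∀ (w : V → V → A) (T : Finset V), (∀ x ∈ T, ∀ y ∈ T, x ≠ y → w x y ∈ K) → Reversible w →
    ZeroCycleFree w T → ∀ S ⊆ T, ∀ a ∈ T, ∀ b ∈ T, a ≠ b → a ∉ S → b ∉ S → S.Nonempty →
      Nat.card K ≤ (pathWeights w S a b).ncard + 1 ∨
        S.card + 1 ≤ (pathWeights w S a b).ncard + 2 * Ω (Nat.card K)

variable [Finite A]

/-- With `|K| + 1 + 2 Ω(|K|)` vertices, the weights of the paths from `a` to `b` are all elements
of `K` but the one that would close a zero cycle with the arc from `b` to `a`. This remains so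
after removal of a vertex, which makes `w` a potential difference. -/
theorem ManyPathWeights.card_le [DecidableEq V] {K : AddSubgroup A} (hK : K ≠ ⊥)
    (hmany : ManyPathWeights V K) {w : V → V → A} {T : Finset V}
    (hwK : ∀ x ∈ T, ∀ y ∈ T, x ≠ y → w x y ∈ K) (hrev : Reversible w) (hz : ZeroCycleFree w T) :
    T.card ≤ Nat.card K + 2 * Ω (Nat.card K) := by
  by_contra! hT
  have hK1 : 1 < Nat.card K := K.one_lt_card_iff_ne_bot.2 hK
  have hΩ0 : Ω (Nat.card K) ≠ 0 := by
    rw [Ne, ArithmeticFunction.cardFactors_eq_zero_iff_eq_zero_or_one]; omega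
  have hclose : ∀ a ∈ T, ∀ b ∈ T, a ≠ b → ∀ S ⊆ T, a ∉ S → b ∉ S →
      -w b a ∉ pathWeights w S a b := by
    rintro a ha b hb hab S hST haS hbS ⟨l, h0, hl, hlS, h⟩
    refine hz b hb (a :: l) (List.nodup_cons.2 ⟨fun h => haS (hlS a h), hl⟩) ?_ ?_ ?_ ?_
    · simp only [List.mem_cons, not_or]
      exact ⟨hab.symm, fun h => hbS (hlS b h)⟩
    · intro x hx
      rcases List.mem_cons.1 hx with rfl | hx
      · exact ha
      · exact hST (hlS x hx)
    · have := List.length_pos_iff.2 h0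
      rw [List.length_cons]; omega
    · rw [pathWeight_cons, h, add_neg_cancel]
  have hall : ∀ a ∈ T, ∀ b ∈ T, a ≠ b → ∀ S ⊆ T, a ∉ S → b ∉ S →
      Nat.card K + 2 * Ω (Nat.card K) ≤ S.card + 2 → ∀ g ∈ K, g ≠ -w b a →
        g ∈ pathWeights w S a b := by
    intro a ha b hb hab S hST haS hbS hS g hg hgw
    have hsub : pathWeights w S a b ⊆ (K : Set A) \ {-w b a} := fun h hh =>
      ⟨pathWeights_subset hwK hST ha hb haS hbS hab hh, fun h' =>
        hclose a ha b hb hab S hST haS hbS (Set.mem_singleton_iff.1 h' ▸ hh)⟩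
    have hcard : ((K : Set A) \ {-w b a}).ncard + 1 = Nat.card K :=
      Set.ncard_sdiff_singleton_add_one (K.neg_mem (hwK b hb a ha hab.symm)) (Set.toFinite _)
    have heq := Set.eq_of_subset_of_ncard_le hsub (by
      have := hmany w T hwK hrev hz S hST a ha b hb hab haS hbS (Finset.card_pos.1 (by omega))
      omega) (Set.toFinite _)
    rw [heq]
    exact ⟨hg, hgw⟩
  have hpot : ∀ a ∈ T, ∀ b ∈ T, ∀ x ∈ T, a ≠ b → a ≠ x → b ≠ x → w b x = w b a + w a x := by
    intro a ha b hb x hx hab hax hbx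
    by_contra hne
    have h1 := hall x hx b hb hbx.symm (((T.erase a).erase b).erase x)
      (((Finset.erase_subset _ _).trans (Finset.erase_subset _ _)).trans (Finset.erase_subset _ _))
      (by simp) (by simp)
      (by
        have h1 := Finset.pred_card_le_card_erase (s := T) (a := a)
        have h2 := Finset.pred_card_le_card_erase (s := T.erase a) (a := b)
        have h3 := Finset.pred_card_le_card_erase (s := (T.erase a).erase b) (a := x)
        omega)
      (-w b a - w a x)
      (K.sub_mem (K.neg_mem (hwK b hb a ha hab.symm)) (hwK a ha x hx hax))
      (fun h => hne (by rw [← neg_inj, ← h]; abel))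
    have h2 := add_mem_pathWeights w (S := (T.erase a).erase b) (a := a)
      (Finset.mem_erase.2 ⟨hbx.symm, Finset.mem_erase.2 ⟨hax.symm, hx⟩⟩) subset_rfl h1
    rw [add_sub_cancel] at h2
    exact hclose a ha b hb hab _ ((Finset.erase_subset _ _).trans (Finset.erase_subset _ _))
      (by simp) (by simp) h2
  obtain ⟨b, hb⟩ : T.Nonempty := Finset.card_pos.1 (by omega)
  obtain ⟨x, y, z, hx, hy, hz', hxy, hxz, hyz⟩ := Finset.two_lt_card_iff.1
    (show 2 < (T.erase b).card by rw [Finset.card_erase_of_mem hb]; omega)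
  rw [Finset.mem_erase] at hx hy hz'
  refine hz.triangle hx.2 hy.2 hz'.2 hxy hyz hxz ?_
  have h1 := hpot x hx.2 b hb y hy.2 hx.1 hxy hy.1.symm
  have h2 := hpot y hy.2 b hb z hz'.2 hy.1 hyz hz'.1.symm
  have h3 := hpot z hz'.2 b hb x hx.2 hz'.1 hxz.symm hx.1.symm
  rw [eq_sub_of_add_eq' h1.symm, eq_sub_of_add_eq' h2.symm, eq_sub_of_add_eq' h3.symm]
  abel

lemma cardFactors_card_lt {K K' : AddSubgroup A} (h : K' < K) :
    Ω (Nat.card K') + 1 ≤ Ω (Nat.card K) := by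
  obtain ⟨m, hm⟩ := AddSubgroup.card_dvd_of_le h.le
  have hK : Nat.card K ≠ 0 := Nat.card_pos.ne'
  rw [hm] at hK
  rw [hm, ArithmeticFunction.cardFactors_mul (left_ne_zero_of_mul hK) (right_ne_zero_of_mul hK)]
  have : Ω m ≠ 0 := by
    rw [Ne, ArithmeticFunction.cardFactors_eq_zero_iff_eq_zero_or_one, not_or]
    refine ⟨right_ne_zero_of_mul hK, fun h1 => ?_⟩
    rw [h1, mul_one] at hm
    exact h.ne (AddSubgroup.eq_of_le_of_card_ge h.le hm.le)
  omega

end Main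

section Main

variable {V A : Type*} [AddCommGroup A]

open scoped ArithmeticFunction.Omega

/-- The induction step: if there were fewer path weights, then the weights `R` from `a` to `b`
would be almost stable under translation by the defects of the arcs of `S`, taken with respect to
the potential `x ↦ w a x`. The induction hypothesis shows that the defects generate `K`, so `R` is an
arithmetic progression and the defects are at most one step of it. -/
theorem manyPathWeights_of_lt [Finite A] [Finite V] [DecidableEq V] {K : AddSubgroup A} (hK : K ≠ ⊥)
    (ih : ∀ K' < K, K' ≠ ⊥ → ManyPathWeights V K') : ManyPathWeights V K := by
  intro w T hwK hrev hz S
  induction S using Finset.strongInduction with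
  | H S ihS =>
  intro hST a ha b hb hab haS hbS hSne
  by_contra! hcon
  obtain ⟨R, hR⟩ : ∃ R, R = pathWeights w S a b := ⟨_, rfl⟩
  rw [← hR] at hcon
  obtain ⟨h1, h2⟩ := hcon
  have hK1 : 1 < Nat.card K := K.one_lt_card_iff_ne_bot.2 hK
  have hΩ0 : Ω (Nat.card K) ≠ 0 := by
    rw [Ne, ArithmeticFunction.cardFactors_eq_zero_iff_eq_zero_or_one]; omega
  have hRpos : 0 < R.ncard :=
    (Set.ncard_pos (Set.toFinite R)).2 (hR ▸ pathWeights_nonempty w hSne a b)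
  have hRK : R ⊆ K := hR ▸ pathWeights_subset hwK hST ha hb haS hbS hab
  have hne : ∀ x ∈ S, a ≠ x := fun x hx h => haS (h ▸ hx)
  have hneb : ∀ x ∈ S, b ≠ x := fun x hx h => hbS (h ▸ hx)
  obtain ⟨δ, hδ⟩ : ∃ δ, δ = defect (w a) w := ⟨_, rfl⟩
  have hδrev : Reversible δ := hδ ▸ reversible_defect hrev _
  have hδz : ZeroCycleFree δ S := hδ ▸ zeroCycleFree_defect (hz.mono hST) _
  have hδK : ∀ x ∈ S, ∀ y ∈ S, x ≠ y → δ x y ∈ K := by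
    intro x hx y hy hxy
    rw [hδ]
    exact K.sub_mem (K.sub_mem (hwK a ha y (hST hy) (hne y hy)) (hwK a ha x (hST hx) (hne x hx)))
      (hwK x (hST hx) y (hST hy) hxy)
  obtain ⟨D, hD⟩ : ∃ D : Set A, D = {g | ∃ x ∈ S, ∃ y ∈ S, x ≠ y ∧ δ x y = g} := ⟨_, rfl⟩
  have hmemD : ∀ x ∈ S, ∀ y ∈ S, x ≠ y → δ x y ∈ D := fun x hx y hy h =>
    hD ▸ ⟨x, hx, y, hy, h, rfl⟩
  -- `Q` consists of the weights of the paths that go from `a` to `y` first and avoid `x`; inserting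
  -- `x` between `a` and `y` subtracts the defect of the arc from `x` to `y`.
  have hQ : ∀ g ∈ D, ∃ Q : Set A, Q.Nonempty ∧ Q ⊆ R ∧ (∀ h ∈ Q, h - g ∈ R) ∧
      R.ncard ≤ Q.ncard + 1 := by
    intro g hg
    rw [hD] at hg
    obtain ⟨x, hx, y, hy, hxy, rfl⟩ := hg
    obtain ⟨P, hP⟩ : ∃ P, P = pathWeights w ((S.erase x).erase y) y b := ⟨_, rfl⟩
    have hyx : y ∈ S.erase x := Finset.mem_erase.2 ⟨hxy.symm, hy⟩
    have hcard : ((S.erase x).erase y).card + 2 = S.card := by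
      rw [Finset.card_erase_of_mem hyx, Finset.card_erase_of_mem hx]; omega
    have hPne : ((S.erase x).erase y).Nonempty := Finset.card_pos.1 (by omega)
    have hsub : (S.erase x).erase y ⊂ S :=
      (Finset.erase_ssubset hyx).trans (Finset.erase_ssubset hx)
    have hPih := ihS _ hsub (hsub.subset.trans hST) y (hST hy) b hb (hneb y hy).symm
      (by simp) (fun h => hbS (hsub.subset h)) hPne
    rw [← hP] at hPih
    refine ⟨(fun h => w a y + h) '' P, ?_, ?_, ?_, ?_⟩
    · rw [hP]; exact (pathWeights_nonempty w hPne y b).image _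
    · rintro _ ⟨h, hh, rfl⟩
      rw [hR]
      refine add_mem_pathWeights w hy ?_ (hP ▸ hh)
      exact Finset.erase_subset_erase _ (Finset.erase_subset _ _)
    · rintro _ ⟨h, hh, rfl⟩
      have h3 : w a y + h - δ x y = w a x + (w x y + h) := by rw [hδ, defect]; abel
      simp only [h3]
      rw [hR]
      exact add_mem_pathWeights w hx subset_rfl (add_mem_pathWeights w hyx subset_rfl (hP ▸ hh))
    · rw [Set.ncard_image_of_injective _ (add_right_injective _)]
      omega
  have hclK : AddSubgroup.closure D ≤ K := by
    rw [AddSubgroup.closure_le, hD]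
    rintro _ ⟨x, hx, y, hy, hxy, rfl⟩
    exact hδK x hx y hy hxy
  have hbot : AddSubgroup.closure D ≠ ⊥ := by
    intro h
    have h0 : ∀ x ∈ S, ∀ y ∈ S, x ≠ y → δ x y = 0 := fun x hx y hy hxy => by
      rw [← AddSubgroup.mem_bot, ← h]
      exact AddSubgroup.subset_closure (hmemD x hx y hy hxy)
    obtain ⟨x, y, z, hx, hy, hz', hxy, hxz, hyz⟩ := Finset.two_lt_card_iff.1
      (show 2 < S.card by omega)
    refine hδz.triangle hx hy hz' hxy hyz hxz ?_
    rw [h0 x hx y hy hxy, h0 y hy z hz' hyz, h0 z hz' x hx hxz.symm]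
    simp
  rcases hclK.lt_or_eq with hlt | heq
  · have hΩ := cardFactors_card_lt hlt
    have hδK' : ∀ x ∈ S, ∀ y ∈ S, x ≠ y → δ x y ∈ AddSubgroup.closure D := fun x hx y hy hxy =>
      AddSubgroup.subset_closure (hmemD x hx y hy hxy)
    have hmany := ih _ hlt hbot
    have hbound := hmany.card_le hbot hδK' hδrev hδz
    obtain ⟨x, hx, z, hz', hxz⟩ := Finset.one_lt_card.1 (show 1 < S.card by omega)
    have hzx : z ∈ S.erase x := Finset.mem_erase.2 ⟨hxz.symm, hz'⟩
    have hcard : ((S.erase x).erase z).card + 2 = S.card := by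
      rw [Finset.card_erase_of_mem hzx, Finset.card_erase_of_mem hx]; omega
    have hclaim := hmany δ S hδK' hδrev hδz ((S.erase x).erase z)
      ((Finset.erase_subset _ _).trans (Finset.erase_subset _ _)) x hx z hz' hxz (by simp) (by simp)
      (Finset.card_pos.1 (by omega))
    have hle : (pathWeights δ ((S.erase x).erase z) x z).ncard ≤ R.ncard := by
      refine Set.ncard_le_ncard_of_injOn (fun h => w a z + w z b - h) ?_
        (sub_right_injective.injOn) (Set.toFinite R)
      rintro _ ⟨l, -, hl, hlS, rfl⟩
      have h3 : w a z + w z b - pathWeight δ x l z = pathWeight w a (x :: l ++ z :: []) b := by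
        rw [hδ, pathWeight_defect, pathWeight_append, pathWeight_cons, pathWeight_nil]
        abel
      simp only [h3]
      have hlS' : ∀ u ∈ l, u ≠ z ∧ u ≠ x ∧ u ∈ S := fun u hu => by
        have := hlS u hu
        rwa [Finset.mem_erase, Finset.mem_erase] at this
      rw [hR]
      refine ⟨_, by simp, ?_, ?_, rfl⟩
      · rw [List.nodup_append, List.nodup_cons]
        refine ⟨⟨fun h => (hlS' x h).2.1 rfl, hl⟩, by simp, ?_⟩
        intro u hu v hv
        rw [List.mem_singleton] at hv
        subst hv
        rcases List.mem_cons.1 hu with rfl | hu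
        · exact hxz
        · exact (hlS' u hu).1
      · intro u hu
        rcases List.mem_append.1 hu with hu | hu
        · rcases List.mem_cons.1 hu with rfl | hu
          · exact hx
          · exact (hlS' u hu).2.2
        · rw [List.mem_singleton] at hu; exact hu ▸ hz'
    omega
  · have hR2 : 2 ≤ R.ncard := by
      by_contra h
      refine hK ?_
      rw [← heq, eq_bot_iff, AddSubgroup.closure_le]
      intro g hg
      obtain ⟨Q, ⟨h, hh⟩, hQR, hQg, -⟩ := hQ g hg
      have := (Set.ncard_le_one (Set.toFinite R)).1 (by omega) _ (hQR hh) _ (hQg h hh)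
      have h0 : g = 0 := by rw [← sub_sub_cancel h g, ← this, sub_self]
      simp [h0]
    obtain ⟨d, e, hdK, hDd, hRd⟩ := exists_arithmetic_progression heq hRK
      (Set.one_lt_ncard_iff_nontrivial_and_finite.1 hR2).1 (by omega)
      (fun g hg u hu v hv hug hvg => by
        obtain ⟨Q, -, hQR, hQg, hcard⟩ := hQ g hg
        exact eq_of_mem_diff_of_ncard_le hQR hcard hu hv (fun h => hug (hQg u h))
          (fun h => hvg (hQg v h)))
      (fun g hg u hu v hv hug hvg => by
        obtain ⟨Q, -, hQR, hQg, hcard⟩ := hQ g hg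
        rw [← Set.ncard_image_of_injective Q (sub_left_injective (b := g))] at hcard
        refine eq_of_mem_diff_of_ncard_le (by rintro _ ⟨h, hh, rfl⟩; exact hQg h hh) hcard hu hv ?_ ?_
        · rintro ⟨h, hh, rfl⟩
          exact hug (by simpa using hQR hh)
        · rintro ⟨h, hh, rfl⟩
          exact hvg (by simpa using hQR hh))
    refine window_contradiction hdK hR2 (by omega) hδrev hδz
      (fun x hx y hy hxy => hDd _ (hmemD x hx y hy hxy)) (by omega) (fun z => w a z + w z b)
      (e := e) fun z hz' l hl hlS => ?_
    rw [← hRd, hR]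
    refine ⟨l.reverse ++ z :: [], by simp, ?_, ?_, ?_⟩
    · rw [List.nodup_append]
      refine ⟨List.nodup_reverse.2 hl, by simp, ?_⟩
      intro u hu v hv
      rw [List.mem_singleton] at hv
      subst hv
      exact Finset.ne_of_mem_erase (hlS u (List.mem_reverse.1 hu))
    · intro u hu
      rcases List.mem_append.1 hu with hu | hu
      · exact Finset.mem_of_mem_erase (hlS u (List.mem_reverse.1 hu))
      · rw [List.mem_singleton] at hu; exact hu ▸ hz'
    · rw [pathWeight_append, pathWeight_reverse_eq_sub_backSum, pathWeight_nil, hδ]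
      abel

theorem manyPathWeights [Finite A] [Finite V] (K : AddSubgroup A) (hK : K ≠ ⊥) :
    ManyPathWeights V K := by
  classical
  induction K using WellFoundedLT.induction with
  | ind K ih => exact manyPathWeights_of_lt hK ih

/-- A vertex set with at least `|A| + 1 + 2 Ω(|A|)` members carries a directed cycle of weight zero
with at least three vertices. -/
theorem exists_pathWeight_eq_zero [Finite A] [Nontrivial A] [Fintype V] {w : V → V → A}
    (hrev : Reversible w) (hV : Nat.card A + 1 + 2 * Ω (Nat.card A) ≤ Fintype.card V) :
    ∃ (a : V) (l : List V), l.Nodup ∧ a ∉ l ∧ 2 ≤ l.length ∧ pathWeight w a l a = 0 := by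
  classical
  by_contra! h
  have := (manyPathWeights (V := V) (⊤ : AddSubgroup A) top_ne_bot).card_le top_ne_bot
    (T := Finset.univ) (fun _ _ _ _ _ => AddSubgroup.mem_top _) hrev
    (fun a _ l hl hal _ h2 => h a l hl hal h2)
  rw [AddSubgroup.card_top, Finset.card_univ] at this
  omega

end Main

/-! ### Cycles in complete graphs -/

section Graph

variable {V A : Type*} [AddCommGroup A]

lemma exists_walk_of_list (w : V → V → A) (wV : V → A) (wE : Sym2 V → A)
    (hw : ∀ x y, w x y = wE s(x, y) + wV y) {a : V} {l : List V} {b : V} (hl : l.Nodup)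
    (hal : a ∉ l) (hbl : b ∉ l) (hab : a ≠ b) :
    ∃ p : (⊤ : SimpleGraph V).Walk a b, p.support = a :: (l ++ [b]) ∧
      (p.support.tail.map wV).sum + (p.edges.map wE).sum = pathWeight w a l b := by
  induction l generalizing a with
  | nil =>
    exact ⟨.cons ((SimpleGraph.top_adj a b).2 hab) .nil, by simp, by simp [hw, add_comm]⟩
  | cons x l ih =>
    simp only [List.mem_cons, not_or, List.nodup_cons] at *
    obtain ⟨p, hp, hpw⟩ := ih hl.2 hl.1 hbl.2 (Ne.symm hbl.1)
    refine ⟨.cons ((SimpleGraph.top_adj a x).2 hal.1) p, by simp [hp], ?_⟩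
    rw [pathWeight_cons, ← hpw, hw]
    simp only [SimpleGraph.Walk.support_cons, SimpleGraph.Walk.edges_cons, List.tail_cons, hp,
      List.map_cons, List.sum_cons]
    abel

lemma weight_toSubgraph_of_isCycle {G : SimpleGraph V} (wV : V → A) (wE : Sym2 V → A) {v : V}
    {C : G.Walk v v} (hC : C.IsCycle) :
    C.toSubgraph.weight wV wE = (C.support.tail.map wV).sum + (C.edges.map wE).sum := by
  classical
  have hV : C.toSubgraph.verts = (C.support.tail.toFinset : Set V) := by
    ext x
    rw [SimpleGraph.Walk.verts_toSubgraph, Set.mem_ofPred_eq, List.coe_toFinset, Set.mem_ofPred_eq]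
    refine ⟨fun h => ?_, List.mem_of_mem_tail⟩
    rw [← SimpleGraph.Walk.cons_tail_support, List.mem_cons] at h
    rcases h with rfl | h
    · exact C.end_mem_tail_support hC.not_nil
    · exact h
  have hE : C.toSubgraph.edgeSet = (C.edges.toFinset : Set (Sym2 V)) := by
    ext e
    rw [SimpleGraph.Walk.mem_edges_toSubgraph, List.coe_toFinset, Set.mem_ofPred_eq]
  rw [SimpleGraph.Subgraph.weight, hV, hE, finsum_mem_coe_finset, finsum_mem_coe_finset,
    List.sum_toFinset _ hC.support_nodup, List.sum_toFinset _ hC.isTrail.edges_nodup]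

/-- A list of at least two further vertices spans a cycle through `a` in the complete graph. As each
vertex is counted with the arc that enters it, the weight of the cycle is that of the closed
directed path. -/
lemma exists_isCycle_of_pathWeight (w : V → V → A) (wV : V → A) (wE : Sym2 V → A)
    (hw : ∀ x y, w x y = wE s(x, y) + wV y) {a : V} {l : List V} (hl : l.Nodup) (hal : a ∉ l)
    (h2 : 2 ≤ l.length) :
    ∃ C : (⊤ : SimpleGraph V).Walk a a, C.IsCycle ∧
      C.toSubgraph.weight wV wE = pathWeight w a l a := by
  obtain ⟨x, y, l, rfl⟩ : ∃ x y l', l = x :: y :: l' := by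
    match l, h2 with
    | x :: y :: l', _ => exact ⟨x, y, l', rfl⟩
  simp only [List.mem_cons, not_or, List.nodup_cons] at hl hal
  obtain ⟨p, hp, hpw⟩ := exists_walk_of_list w wV wE hw hl.2.2 hl.2.1 hal.2.2 (Ne.symm hal.2.1)
  have hpath : p.IsPath := by
    rw [SimpleGraph.Walk.isPath_def, hp, List.nodup_cons, List.nodup_append]
    refine ⟨?_, hl.2.2, by simp, ?_⟩
    · simp only [List.mem_append, List.mem_singleton, not_or]
      exact ⟨hl.2.1, Ne.symm hal.2.1⟩
    · intro u hu v hv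
      rw [List.mem_singleton] at hv
      exact fun h => hal.2.2 (hv ▸ h ▸ hu)
  have hxp : x ∉ p.support := by
    rw [hp]
    simp only [List.mem_cons, List.mem_append, not_or, List.not_mem_nil]
    exact ⟨hl.1.1, hl.1.2, Ne.symm hal.1, not_false⟩
  have hxy := (SimpleGraph.top_adj x y).2 hl.1.1
  have hax := (SimpleGraph.top_adj a x).2 hal.1
  have hC : (SimpleGraph.Walk.cons hax (.cons hxy p)).IsCycle := by
    rw [SimpleGraph.Walk.cons_isCycle_iff]
    refine ⟨hpath.cons hxp, fun h => ?_⟩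
    rw [SimpleGraph.Walk.edges_cons, List.mem_cons] at h
    rcases h with h | h
    · rw [Sym2.eq_iff] at h
      rcases h with h | h
      · exact hal.1 h.1
      · exact hal.2.1 h.1
    · exact hxp (p.snd_mem_support_of_mem_edges h)
  refine ⟨_, hC, ?_⟩
  rw [weight_toSubgraph_of_isCycle wV wE hC, pathWeight_cons, pathWeight_cons, ← hpw, hw, hw]
  simp only [SimpleGraph.Walk.support_cons, SimpleGraph.Walk.edges_cons, List.tail_cons, hp,
    List.map_cons, List.sum_cons]
  abel

end Graph

theorem mainTheorem2 {V : Type*} [Fintype V] (G : SimpleGraph V) (hG : G = ⊤)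
    (k : ℕ) (hk : 2 ≤ k) (hV : Fintype.card V = k + 1 + 2 * ArithmeticFunction.cardFactors k)
    (wV : V → ZMod k) (wE : Sym2 V → ZMod k) :
    ∃ (v : V) (C : G.Walk v v), C.IsCycle ∧ C.toSubgraph.weight wV wE = 0 := by
  subst hG
  have : NeZero k := ⟨by omega⟩
  have : Fact (1 < k) := ⟨hk⟩
  obtain ⟨a, l, hl, hal, h2, h0⟩ := exists_pathWeight_eq_zero
    (w := fun x y => wE s(x, y) + wV y)
    ⟨wV, fun x y => by beta_reduce; rw [Sym2.eq_swap]; abel⟩ (by rw [Nat.card_zmod, hV])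
  obtain ⟨C, hC, hCw⟩ := exists_isCycle_of_pathWeight _ wV wE (fun _ _ => rfl) hl hal h2
  exact ⟨a, C, hC, hCw.trans h0⟩
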